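/- Let $G=(V,E)$ be a finite simple undirected graph with edge weights $w(e)\ge 0$ such that the edges of positive weight connect $V$ (for strictly positive weights, e.g. $w(e)=\exp(-\mu c(e))$ with real edge costs $c(e)$ and $\mu\ge 0$, this just says that $G$ is connected). The weight of a graph is the product of its edge weights, and the weight of a set of graphs is the sum of the weights of its members. Let $\mathcal T$ be the set of spanning trees of $G$; let $\mathcal F_u^v$ be the set of spanning forests of $G$ consisting of exactly two trees such that $u$ and $v$ lie in different trees; and let $\mathcal F_{u,q}^{v}=\mathcal F_u^v\cap\mathcal F_q^v$. For distinct seeds $s_1,s_2\in V$ and $q\in V$ let $$P(q\sim s_1)=\sum_{f\in\mathcal F_{s_1,q}^{s_2}}\frac{w(f)}{w(\mathcal F_{s_1}^{s_2})}$$ be the probability that a forest sampled from $\mathcal F_{s_1}^{s_2}$ with probability proportional to its weight connects $q$ with $s_1$, and define $P(q\sim s_2)$ in the same way with $s_1$ and $s_2$ exchanged. Let $L$ be the weighted Laplacian of $G$, and for $u,v\in V$ let $R(u,v)=(\nu_u-\nu_v)/I$ be the effective resistance, where $I\neq0$ and $\nu\in\mathbb R^V$ is a potential for a current $I$ from $u$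 to $v$, i.e. $L\nu=I(\mathbf 1_u-\mathbf 1_v)$. Then: 1. For all $u,v\in V$ the effective resistance is well defined: a potential exists for $I=1$, and $(\nu_u-\nu_v)/I$ is the same for all $I\ne0$ and all potentials $\nu$ for the current $I$ from $u$ to $v$. 2. $w(\mathcal T)>0$, and for all $u,v\in V$, $$R(u,v)=\frac{w(\mathcal F_u^v)}{w(\mathcal T)}.$$ 3. For all $s_1\ne s_2$ and $q$ in $V$ we have $w(\mathcal F_{s_1}^{s_2})>0$, $R(s_1,s_2)>0$, the triangle inequality $R(s_1,q)\le R(s_1,s_2)+R(s_2,q)$, and $$P(q\sim s_1)=\frac{R(s_2,q)+R(s_1,s_2)-R(s_1,q)}{2R(s_1,s_2)},$$ so that for fixed seeds $P(q\sim s_1)$ is proportional to the gap in this triangle inequality. 4. For all $s_1\ne s_2$ and $q$ in $V$, $$P(q\sim s_1)\ge P(q\sim s_2)\iff R(s_1,q)\le R(s_2,q).$$ -/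

import Mathlib

namespace ProbWatershed

variable {V : Type*}

/-- The spanning subgraph of `G` formed by its edges of positive weight. -/
def positivePart (G : SimpleGraph V) (w : Sym2 V → ℝ) : SimpleGraph V where
  Adj x y := G.Adj x y ∧ 0 < w s(x, y)
  symm := ⟨fun x y h => ⟨h.1.symm, by rw [Sym2.eq_swap]; exact h.2⟩⟩
  loopless := ⟨fun x h => G.loopless.irrefl x h.1⟩

/-- For strictly positive weights, such as `w e = exp (-μ * c e)`, the positive part is `G`. -/
theorem positivePart_eq (G : SimpleGraph V) (w : Sym2 V → ℝ) (hw : ∀ e ∈ G.edgeSet, 0 < w e) :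
    positivePart G w = G := by
  ext x y
  exact ⟨fun h => h.1, fun h => ⟨h, hw _ h⟩⟩

variable [Fintype V]

open Classical in
/-- The weight of a graph: the product of the weights of its edges. -/
noncomputable def graphWeight (w : Sym2 V → ℝ) (H : SimpleGraph V) : ℝ :=
  ∏ e ∈ H.edgeFinset, w e

open Classical in
/-- The weight of a set of graphs: the sum of the weights of its members. -/
noncomputable def setWeight (w : Sym2 V → ℝ) (S : Set (SimpleGraph V)) : ℝ :=
  ∑ H ∈ S.toFinset, graphWeight w H

/-- The spanning trees of `G`, as graphs on the whole vertex set. -/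
def spanningTrees (G : SimpleGraph V) : Set (SimpleGraph V) :=
  {t | t ≤ G ∧ t.IsTree}

/-- The spanning forests of `G` with exactly two trees, `u` and `v` lying in different trees. -/
def twoForests (G : SimpleGraph V) (u v : V) : Set (SimpleGraph V) :=
  {f | f ≤ G ∧ f.IsAcyclic ∧ Nat.card f.ConnectedComponent = 2 ∧ ¬ f.Reachable u v}

/-- The 2-forests of `G` having `u` and `q` in one tree and `v` in the other. -/
def twoForestsWith (G : SimpleGraph V) (u q v : V) : Set (SimpleGraph V) :=
  twoForests G u v ∩ twoForests G q v

/-- The Gibbs probability of the 2-forest `f` among those separating `s₁` and `s₂`. -/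
noncomputable def gibbsProb (G : SimpleGraph V) (w : Sym2 V → ℝ) (s₁ s₂ : V)
    (f : SimpleGraph V) : ℝ :=
  graphWeight w f / setWeight w (twoForests G s₁ s₂)

open Classical in
/-- `P(q ∼ s₁)`: the probability that a 2-forest sampled from the Gibbs distribution on the
2-forests separating `s₁` and `s₂` connects `q` to `s₁`. -/
noncomputable def connProb (G : SimpleGraph V) (w : Sym2 V → ℝ) (s₁ s₂ q : V) : ℝ :=
  ∑ f ∈ (twoForestsWith G s₁ q s₂).toFinset, gibbsProb G w s₁ s₂ f

open Classical in
/-- The weighted Laplacian; pairs that are not edges of `G` count with weight `0`. -/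
noncomputable def laplacian (G : SimpleGraph V) (w : Sym2 V → ℝ) : Matrix V V ℝ :=
  fun x y =>
    if x = y then ∑ k : V, (if G.Adj x k then w s(x, k) else 0)
    else if G.Adj x y then - w s(x, y) else 0

open Classical in
/-- `ν` is a potential for a current `I` entering the network at `u` and leaving it at `v`,
each edge `e` being a conductor of resistance `1 / w e`. By Ohm's and Kirchhoff's laws,
`L ν = I • (1_u - 1_v)`. -/
def IsPotential (G : SimpleGraph V) (w : Sym2 V → ℝ) (I : ℝ) (u v : V) (ν : V → ℝ) : Prop :=
  (laplacian G w).mulVec ν = I • (Pi.single u 1 - Pi.single v 1)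

/-- The effective resistance `(ν_u - ν_v) / I`, where `ν` is a potential for a nonzero current `I`
from `u` to `v`. -/
noncomputable def effRes (G : SimpleGraph V) (w : Sym2 V → ℝ) (u v : V) : ℝ :=
  Classical.epsilon fun r : ℝ =>
    ∃ (I : ℝ) (ν : V → ℝ), I ≠ 0 ∧ IsPotential G w I u v ν ∧ r = (ν u - ν v) / I

end ProbWatershed

/-!
For fixed `v`, the function `x ↦ w(F_{u,x}^v)` is, up to the factor `w(T)`, the potential of a unit
current from `u` to `v`. Two identities give this. Deleting the first edge `xk` of the path from `x`
to `u ≠ x` in a spanning tree leaves a 2-forest with `x` alone on one side of `k` and `u`, and this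
is reversible, so `∑ k, w(xk) w(F_{k,u}^x) = w(T)`. On the other hand a 2-forest separating two
vertices puts any third one with exactly one of them, which makes `2 w(F_{u,q}^v)` the gap
`w(F_v^q) + w(F_u^v) - w(F_u^q)` and hence
`w(F_{u,x}^v) - w(F_{u,k}^v) = w(F_{k,v}^x) - w(F_{k,u}^x)`. Multiplying by `w(xk)` and summing over
the neighbours `k` of `x` yields Kirchhoff's law at `x`. Evaluating the potential at `u` and `v`
gives `R(u,v) = w(F_u^v) / w(T)`, and the gap identity becomes the formula for `P(q ∼ s₁)`.
-/

namespace ProbWatershed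

open SimpleGraph

section Graph

variable {V : Type*} {G f t : SimpleGraph V} {u v x k : V}

theorem positivePart_le (G : SimpleGraph V) (w : Sym2 V → ℝ) : positivePart G w ≤ G :=
  fun _ _ h => h.1

theorem card_connectedComponent_eq_two_iff (hxk : ¬ f.Reachable x k) :
    Nat.card f.ConnectedComponent = 2 ↔ ∀ y, f.Reachable y x ∨ f.Reachable y k := by
  have hne : f.connectedComponentMk k ≠ f.connectedComponentMk x :=
    fun h => hxk (ConnectedComponent.exact h).symm
  rw [Nat.card_eq_two_iff' (f.connectedComponentMk x)]
  constructor
  · intro h y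
    rw [← ConnectedComponent.eq, ← ConnectedComponent.eq, or_iff_not_imp_left]
    exact fun hy => h.unique hy hne
  · refine fun h => ⟨_, hne, ConnectedComponent.ind fun y hy => ?_⟩
    exact ConnectedComponent.sound ((h y).resolve_left fun hyx => hy (ConnectedComponent.sound hyx))

theorem reachable_deleteEdges_or_reachable_deleteEdges {y : V} (h : t.Reachable y x) (k : V) :
    (t.deleteEdges {s(x, k)}).Reachable y x ∨ (t.deleteEdges {s(x, k)}).Reachable y k := by
  obtain ⟨p⟩ := h
  induction p with
  | nil => exact Or.inl .rfl
  | @cons a b c hab p ih =>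
    by_cases he : s(a, b) = s(c, k)
    · rcases Sym2.eq_iff.1 he with ⟨rfl, -⟩ | ⟨rfl, -⟩
      · exact Or.inl .rfl
      · exact Or.inr .rfl
    · have hab' : (t.deleteEdges {s(c, k)}).Reachable a b :=
        Adj.reachable (deleteEdges_adj.2 ⟨hab, he⟩)
      exact ih.imp hab'.trans hab'.trans

theorem not_reachable_deleteEdges_of_isAcyclic (ht : t.IsAcyclic) (hxk : t.Adj x k) :
    ¬ (t.deleteEdges {s(x, k)}).Reachable x k :=
  isBridge_iff.1 (isAcyclic_iff_forall_adj_isBridge.1 ht hxk)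

theorem deleteEdges_mem_twoForests (ht : t ∈ spanningTrees G) (hxk : t.Adj x k) :
    t.deleteEdges {s(x, k)} ∈ twoForests G x k := by
  obtain ⟨hle, htree⟩ := ht
  have hsep := not_reachable_deleteEdges_of_isAcyclic htree.isAcyclic hxk
  exact ⟨(t.deleteEdges_le _).trans hle, htree.isAcyclic.anti (t.deleteEdges_le _),
    (card_connectedComponent_eq_two_iff hsep).2 fun y =>
      reachable_deleteEdges_or_reachable_deleteEdges (htree.connected.preconnected y x) k, hsep⟩

theorem sup_edge_mem_spanningTrees (hG : G.Adj x k) (hf : f ∈ twoForests G x k) :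
    f ⊔ edge x k ∈ spanningTrees G := by
  obtain ⟨hle, hacyclic, hcard, hsep⟩ := hf
  have hkx : (f ⊔ edge x k).Reachable k x :=
    Adj.reachable (Or.inr ((edge_adj x k k x).2 ⟨Or.inr ⟨rfl, rfl⟩, hG.ne'⟩))
  have hx : ∀ y, (f ⊔ edge x k).Reachable y x := fun y =>
    ((card_connectedComponent_eq_two_iff hsep).1 hcard y).elim (fun h => h.mono le_sup_left)
      fun h => (h.mono le_sup_left).trans hkx
  exact ⟨sup_le hle ((edge_le_iff G).2 (Or.inr hG)),
    (connected_iff _).2 ⟨fun a b => (hx a).trans (hx b).symm, ⟨x⟩⟩,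
    hacyclic.sup_edge_of_not_reachable hsep⟩

theorem deleteEdges_sup_edge (hxk : ¬ f.Adj x k) :
    (f ⊔ edge x k).deleteEdges {s(x, k)} = f := by
  rw [deleteEdges_sup, deleteEdges_edge (Set.mem_singleton _), sup_bot_eq, deleteEdges_eq_self,
    Set.disjoint_singleton_right, mem_edgeSet]
  exact hxk

theorem sup_edge_deleteEdges (hxk : t.Adj x k) :
    t.deleteEdges {s(x, k)} ⊔ edge x k = t :=
  sdiff_sup_cancel ((edge_le_iff t).2 (Or.inr hxk))

theorem existsUnique_adj_not_reachable_deleteEdges (ht : t.IsAcyclic) (hxu : t.Reachable x u)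
    (hne : u ≠ x) : ∃! k, t.Adj x k ∧ ¬ (t.deleteEdges {s(x, k)}).Reachable u x := by
  obtain ⟨p, hp⟩ := hxu.exists_isPath
  have hunique : ∀ k, ¬ (t.deleteEdges {s(x, k)}).Reachable u x → k = p.snd := fun k hk =>
    hp.eq_snd_of_mem_edges (p.mem_edges_of_not_reachable_deleteEdges fun h => hk h.symm)
  refine ⟨p.snd, ?_, fun k hk => hunique k hk.2⟩
  cases p with
  | nil => exact absurd rfl hne
  | @cons _ b _ hxb p =>
    rw [Walk.snd_cons]
    have hxp : x ∉ p.support := ((Walk.cons_isPath_iff hxb p).1 hp).2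
    have hbu : (t.deleteEdges {s(x, b)}).Reachable b u :=
      ⟨p.toDeleteEdge s(x, b) fun h => hxp (p.fst_mem_support_of_mem_edges h)⟩
    exact ⟨hxb, fun hux => not_reachable_deleteEdges_of_isAcyclic ht hxb (hbu.trans hux).symm⟩

/-- The spanning trees of `G` in which the path from `x` to `u` starts with the edge `xk`. This is
encoded by the condition that deleting the edge cuts off `u` from `x`. -/
def spanningTreesVia (G : SimpleGraph V) (x k u : V) : Set (SimpleGraph V) :=
  {t ∈ spanningTrees G | t.Adj x k ∧ ¬ (t.deleteEdges {s(x, k)}).Reachable u x}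

theorem twoForests_comm (G : SimpleGraph V) (u v : V) : twoForests G u v = twoForests G v u := by
  simp only [twoForests, reachable_comm]

theorem twoForestsWith_comm (G : SimpleGraph V) (u q v : V) :
    twoForestsWith G u q v = twoForestsWith G q u v :=
  Set.inter_comm _ _

theorem not_adj_of_mem_twoForests (hf : f ∈ twoForests G x k) : ¬ f.Adj x k :=
  fun h => hf.2.2.2 h.reachable

theorem twoForests_self (G : SimpleGraph V) (v : V) : twoForests G v v = ∅ :=
  Set.eq_empty_of_forall_notMem fun _ hf => hf.2.2.2 .rfl

theorem twoForestsWith_left (G : SimpleGraph V) (u v : V) :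
    twoForestsWith G u u v = twoForests G u v :=
  Set.inter_self _

theorem twoForestsWith_right (G : SimpleGraph V) (u v : V) : twoForestsWith G u v v = ∅ := by
  rw [twoForestsWith, twoForests_self, Set.inter_empty]

theorem twoForests_eq_union (G : SimpleGraph V) (u q v : V) :
    twoForests G u v = twoForestsWith G u q v ∪ twoForestsWith G v q u := by
  ext f
  constructor
  · intro hf
    have ⟨hle, hacyclic, hcard, hsep⟩ := hf
    rcases (card_connectedComponent_eq_two_iff hsep).1 hcard q with h | h
    · exact Or.inl ⟨hf, hle, hacyclic, hcard, fun hqv => hsep (h.symm.trans hqv)⟩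
    · refine Or.inr ⟨twoForests_comm G u v ▸ hf, hle, hacyclic, hcard, fun hqu => ?_⟩
      exact hsep (hqu.symm.trans h)
  · rintro (hf | hf)
    · exact hf.1
    · exact twoForests_comm G v u ▸ hf.1

theorem disjoint_twoForestsWith (G : SimpleGraph V) (u q v : V) :
    Disjoint (twoForestsWith G u q v) (twoForestsWith G v q u) := by
  refine Set.disjoint_left.2 fun f hf hf' => ?_
  obtain ⟨⟨-, -, hcard, huv⟩, -, -, -, hqv⟩ := hf
  obtain ⟨-, -, -, -, hqu⟩ := hf'
  exact ((card_connectedComponent_eq_two_iff huv).1 hcard q).elim hqu hqv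

theorem bijOn_sup_edge (hG : G.Adj x k) (u : V) :
    Set.BijOn (· ⊔ edge x k) (twoForestsWith G k u x) (spanningTreesVia G x k u) := by
  have hnadj : ∀ f ∈ twoForestsWith G k u x, ¬ f.Adj x k :=
    fun f hf h => not_adj_of_mem_twoForests hf.1 h.symm
  refine Set.InvOn.bijOn (f' := (deleteEdges · {s(x, k)}))
    ⟨fun f hf => deleteEdges_sup_edge (hnadj f hf), fun t ht => sup_edge_deleteEdges ht.2.1⟩ ?_ ?_
  · intro f hf
    refine ⟨sup_edge_mem_spanningTrees hG (twoForests_comm G x k ▸ hf.1),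
      Or.inr ((edge_adj x k x k).2 ⟨Or.inl ⟨rfl, rfl⟩, hG.ne⟩), ?_⟩
    rw [deleteEdges_sup_edge (hnadj f hf)]
    exact hf.2.2.2.2
  · rintro t ⟨ht, hxk, hsep⟩
    have hforest := deleteEdges_mem_twoForests ht hxk
    exact ⟨twoForests_comm G x k ▸ hforest, hforest.1, hforest.2.1, hforest.2.2.1, hsep⟩

theorem iUnion_spanningTreesVia (G : SimpleGraph V) (hux : u ≠ x) :
    ⋃ k, spanningTreesVia G x k u = spanningTrees G := by
  refine (Set.iUnion_subset fun k t ht => ht.1).antisymm fun t ht => Set.mem_iUnion.2 ?_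
  obtain ⟨k, hk, -⟩ := existsUnique_adj_not_reachable_deleteEdges ht.2.isAcyclic
    (ht.2.connected.preconnected x u) hux
  exact ⟨k, ht, hk⟩

theorem pairwise_disjoint_spanningTreesVia (G : SimpleGraph V) (hux : u ≠ x) :
    Pairwise (Function.onFun Disjoint fun k => spanningTreesVia G x k u) := by
  refine fun k l hkl => Set.disjoint_left.2 fun t hk hl => hkl ?_
  exact (existsUnique_adj_not_reachable_deleteEdges hk.1.2.isAcyclic
    (hk.1.2.connected.preconnected x u) hux).unique hk.2 hl.2

theorem twoForests_nonempty (hG : G.Connected) (huv : u ≠ v) : (twoForests G u v).Nonempty := by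
  obtain ⟨t, ht⟩ : (spanningTrees G).Nonempty := hG.exists_isTree_le
  rw [← iUnion_spanningTreesVia G huv] at ht
  obtain ⟨k, hk⟩ := Set.mem_iUnion.1 ht
  obtain ⟨f, hf, -⟩ := (bijOn_sup_edge (hk.1.1 hk.2.1) u).surjOn hk
  exact ⟨f, hf.2⟩

end Graph

section Weight

variable {V : Type*} [Fintype V] {G f H : SimpleGraph V} {w : Sym2 V → ℝ}
  {S T : Set (SimpleGraph V)} {u v x k : V}

theorem graphWeight_eq_finprod_mem (w : Sym2 V → ℝ) (H : SimpleGraph V) :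
    graphWeight w H = ∏ᶠ e ∈ H.edgeSet, w e := by
  classical
  exact (finprod_mem_eq_toFinset_prod _ _).symm

theorem graphWeight_sup_edge (w : Sym2 V → ℝ) (hxk : ¬ f.Adj x k) (hne : x ≠ k) :
    graphWeight w (f ⊔ edge x k) = w s(x, k) * graphWeight w f := by
  simp only [graphWeight_eq_finprod_mem]
  rw [edgeSet_sup, edgeSet_edge_of_ne hne, Set.union_singleton]
  exact finprod_mem_insert w hxk f.edgeSet.toFinite

theorem graphWeight_nonneg (hw : ∀ e ∈ G.edgeSet, 0 ≤ w e) (hH : H ≤ G) : 0 ≤ graphWeight w H := by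
  classical
  exact Finset.prod_nonneg fun e he => hw e (edgeSet_mono hH (mem_edgeFinset.1 he))

theorem graphWeight_pos (hH : H ≤ positivePart G w) : 0 < graphWeight w H := by
  classical
  refine Finset.prod_pos fun e he => ?_
  induction e with
  | _ x y => exact (hH (mem_edgeFinset.1 he)).2

theorem setWeight_eq_finsum_mem (w : Sym2 V → ℝ) (S : Set (SimpleGraph V)) :
    setWeight w S = ∑ᶠ H ∈ S, graphWeight w H := by
  classical
  exact (finsum_mem_eq_toFinset_sum _ _).symm

theorem setWeight_empty (w : Sym2 V → ℝ) : setWeight w ∅ = 0 := by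
  rw [setWeight_eq_finsum_mem, finsum_mem_empty]

theorem setWeight_union (w : Sym2 V → ℝ) (hST : Disjoint S T) :
    setWeight w (S ∪ T) = setWeight w S + setWeight w T := by
  simp only [setWeight_eq_finsum_mem]
  exact finsum_mem_union hST S.toFinite T.toFinite

theorem setWeight_iUnion {ι : Type*} [Fintype ι] (w : Sym2 V → ℝ) {S : ι → Set (SimpleGraph V)}
    (hS : Pairwise (Function.onFun Disjoint S)) :
    setWeight w (⋃ i, S i) = ∑ i, setWeight w (S i) := by
  simp only [setWeight_eq_finsum_mem]
  rw [finsum_mem_iUnion hS fun i => (S i).toFinite, finsum_eq_sum_of_fintype]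

theorem setWeight_nonneg (hw : ∀ e ∈ G.edgeSet, 0 ≤ w e) (hS : S ⊆ Set.Iic G) :
    0 ≤ setWeight w S := by
  classical
  exact Finset.sum_nonneg fun _ hH => graphWeight_nonneg hw (hS (Set.mem_toFinset.1 hH))

theorem setWeight_pos (hw : ∀ e ∈ G.edgeSet, 0 ≤ w e) (hS : S ⊆ Set.Iic G) (hHS : H ∈ S)
    (hH : H ≤ positivePart G w) : 0 < setWeight w S := by
  classical
  exact Finset.sum_pos' (fun _ hf => graphWeight_nonneg hw (hS (Set.mem_toFinset.1 hf)))
    ⟨H, Set.mem_toFinset.2 hHS, graphWeight_pos hH⟩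

theorem setWeight_spanningTrees_pos (hw : ∀ e ∈ G.edgeSet, 0 ≤ w e)
    (hconn : (positivePart G w).Connected) : 0 < setWeight w (spanningTrees G) := by
  obtain ⟨t, hle, ht⟩ := hconn.exists_isTree_le
  exact setWeight_pos hw (fun _ h => h.1) ⟨hle.trans (positivePart_le G w), ht⟩ hle

theorem setWeight_twoForests_pos (hw : ∀ e ∈ G.edgeSet, 0 ≤ w e)
    (hconn : (positivePart G w).Connected) (huv : u ≠ v) : 0 < setWeight w (twoForests G u v) := by
  obtain ⟨f, hle, hf⟩ := twoForests_nonempty hconn huv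
  exact setWeight_pos hw (fun _ h => h.1) ⟨hle.trans (positivePart_le G w), hf⟩ hle

theorem setWeight_twoForests_eq_add (G : SimpleGraph V) (w : Sym2 V → ℝ) (u q v : V) :
    setWeight w (twoForests G u v) =
      setWeight w (twoForestsWith G u q v) + setWeight w (twoForestsWith G v q u) := by
  rw [twoForests_eq_union G u q v, setWeight_union w (disjoint_twoForestsWith G u q v)]

theorem two_mul_setWeight_twoForestsWith (G : SimpleGraph V) (w : Sym2 V → ℝ) (u q v : V) :
    2 * setWeight w (twoForestsWith G u q v) = setWeight w (twoForests G v q) +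
      setWeight w (twoForests G u v) - setWeight w (twoForests G u q) := by
  rw [setWeight_twoForests_eq_add G w v u q, setWeight_twoForests_eq_add G w u q v,
    setWeight_twoForests_eq_add G w u v q, twoForestsWith_comm G v u q, twoForestsWith_comm G q u v,
    twoForestsWith_comm G q v u]
  ring

theorem setWeight_twoForestsWith_sub (G : SimpleGraph V) (w : Sym2 V → ℝ) (u v x k : V) :
    setWeight w (twoForestsWith G u x v) - setWeight w (twoForestsWith G u k v) =
      setWeight w (twoForestsWith G k v x) - setWeight w (twoForestsWith G k u x) := by
  have hux := two_mul_setWeight_twoForestsWith G w u x v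
  have huk := two_mul_setWeight_twoForestsWith G w u k v
  have hkv := two_mul_setWeight_twoForestsWith G w k v x
  have hku := two_mul_setWeight_twoForestsWith G w k u x
  rw [twoForests_comm G x v, twoForests_comm G k v] at hkv
  rw [twoForests_comm G x u, twoForests_comm G k u] at hku
  linarith

theorem setWeight_spanningTreesVia (w : Sym2 V → ℝ) (hG : G.Adj x k) (u : V) :
    setWeight w (spanningTreesVia G x k u) = w s(x, k) * setWeight w (twoForestsWith G k u x) := by
  rw [setWeight_eq_finsum_mem, setWeight_eq_finsum_mem, mul_finsum_mem]
  refine (finsum_mem_eq_of_bijOn _ (bijOn_sup_edge hG u) fun f hf => ?_).symm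
  exact (graphWeight_sup_edge w (fun h => not_adj_of_mem_twoForests hf.1 h.symm) hG.ne).symm

theorem sum_mul_setWeight_twoForestsWith [DecidableRel G.Adj] (w : Sym2 V → ℝ) (hux : u ≠ x) :
    ∑ k ∈ G.neighborFinset x, w s(x, k) * setWeight w (twoForestsWith G k u x) =
      setWeight w (spanningTrees G) := by
  rw [← iUnion_spanningTreesVia G hux,
    setWeight_iUnion w (pairwise_disjoint_spanningTreesVia G hux)]
  calc ∑ k ∈ G.neighborFinset x, w s(x, k) * setWeight w (twoForestsWith G k u x)
      = ∑ k ∈ G.neighborFinset x, setWeight w (spanningTreesVia G x k u) :=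
        Finset.sum_congr rfl fun k hk =>
          (setWeight_spanningTreesVia w ((G.mem_neighborFinset x k).1 hk) u).symm
    _ = ∑ k, setWeight w (spanningTreesVia G x k u) :=
        Finset.sum_subset (Finset.subset_univ _) fun k _ hk => by
          have hempty : spanningTreesVia G x k u = ∅ :=
            Set.eq_empty_of_forall_notMem fun t ht =>
              hk ((G.mem_neighborFinset x k).2 (ht.1.1 ht.2.1))
          rw [hempty, setWeight_empty]

end Weight

section Resistance

variable {V : Type*} [Fintype V] {G : SimpleGraph V} {w : Sym2 V → ℝ} {I J : ℝ} {u v : V}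
  {ν μ : V → ℝ}

theorem laplacian_mulVec_apply [DecidableRel G.Adj] (w : Sym2 V → ℝ) (ν : V → ℝ) (x : V) :
    (laplacian G w).mulVec ν x = ∑ k ∈ G.neighborFinset x, w s(x, k) * (ν x - ν k) := by
  classical
  have hentry : ∀ k, laplacian G w x k * ν k =
      (if x = k then ∑ y ∈ G.neighborFinset x, w s(x, y) * ν x else 0) -
        if G.Adj x k then w s(x, k) * ν k else 0 := by
    intro k
    rcases eq_or_ne x k with rfl | hxk
    · simp [laplacian, neighborFinset_eq_filter, Finset.sum_filter, Finset.sum_mul]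
    · by_cases hG : G.Adj x k <;> simp [laplacian, hxk, hG]
  calc (laplacian G w).mulVec ν x = ∑ k, laplacian G w x k * ν k := rfl
    _ = ∑ k ∈ G.neighborFinset x, w s(x, k) * ν x - ∑ k ∈ G.neighborFinset x, w s(x, k) * ν k := by
        rw [Finset.sum_congr rfl fun k _ => hentry k, Finset.sum_sub_distrib,
          Finset.sum_ite_eq, if_pos (Finset.mem_univ x), ← Finset.sum_filter,
          ← neighborFinset_eq_filter]
    _ = ∑ k ∈ G.neighborFinset x, w s(x, k) * (ν x - ν k) := by
        simp only [mul_sub, Finset.sum_sub_distrib]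

theorem laplacian_isSymm (G : SimpleGraph V) (w : Sym2 V → ℝ) : (laplacian G w).IsSymm := by
  ext x y
  by_cases h : x = y
  · rw [h, Matrix.transpose_apply]
  · by_cases hG : G.Adj x y
    · simp [laplacian, h, Ne.symm h, hG, hG.symm, Sym2.eq_swap (a := y)]
    · simp [laplacian, h, Ne.symm h, mt G.adj_symm hG, hG]

theorem isPotential_setWeight_twoForestsWith (G : SimpleGraph V) (w : Sym2 V → ℝ) (u v : V) :
    IsPotential G w (setWeight w (spanningTrees G)) u v
      fun x => setWeight w (twoForestsWith G u x v) := by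
  classical
  have hinflow : ∀ a x : V,
      ∑ k ∈ G.neighborFinset x, w s(x, k) * setWeight w (twoForestsWith G k a x) =
        setWeight w (spanningTrees G) * (1 - (Pi.single a 1 : V → ℝ) x) := by
    intro a x
    rcases eq_or_ne a x with rfl | hax
    · simp [twoForestsWith_right, setWeight_empty]
    · simp [sum_mul_setWeight_twoForestsWith w hax, Pi.single_eq_of_ne hax.symm]
  ext x
  simp only [laplacian_mulVec_apply, setWeight_twoForestsWith_sub G w u v x]
  simp only [mul_sub, Finset.sum_sub_distrib, hinflow, Pi.smul_apply, Pi.sub_apply, smul_eq_mul]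
  ring

theorem IsPotential.smul (c : ℝ) (hν : IsPotential G w I u v ν) :
    IsPotential G w (c * I) u v (c • ν) := by
  rw [IsPotential, Matrix.mulVec_smul, hν, smul_smul]

theorem exists_isPotential (hT : setWeight w (spanningTrees G) ≠ 0) (I : ℝ) (u v : V) :
    ∃ ν, IsPotential G w I u v ν := by
  have hν := (isPotential_setWeight_twoForestsWith G w u v).smul
    (I / setWeight w (spanningTrees G))
  rw [div_mul_cancel₀ I hT] at hν
  exact ⟨_, hν⟩

theorem IsPotential.mul_sub_eq_mul_sub (hν : IsPotential G w I u v ν)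
    (hμ : IsPotential G w J u v μ) : J * (ν u - ν v) = I * (μ u - μ v) := by
  have h : ν ⬝ᵥ (laplacian G w).mulVec μ = μ ⬝ᵥ (laplacian G w).mulVec ν := by
    rw [Matrix.dotProduct_mulVec, ← Matrix.mulVec_transpose, (laplacian_isSymm G w).eq,
      dotProduct_comm]
  rw [hν, hμ] at h
  simpa only [dotProduct_smul, dotProduct_sub, dotProduct_single_one, smul_eq_mul] using h

theorem effRes_eq (hI : I ≠ 0) (hν : IsPotential G w I u v ν) :
    effRes G w u v = (ν u - ν v) / I := by
  obtain ⟨J, μ, hJ, hμ, h⟩ := Classical.epsilon_spec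
    (p := fun r : ℝ => ∃ (I : ℝ) (ν : V → ℝ), I ≠ 0 ∧ IsPotential G w I u v ν ∧
      r = (ν u - ν v) / I) ⟨_, I, ν, hI, hν, rfl⟩
  rw [effRes, h, div_eq_div_iff hJ hI]
  linarith [hν.mul_sub_eq_mul_sub hμ]

theorem effRes_eq_div (hT : setWeight w (spanningTrees G) ≠ 0) (u v : V) :
    effRes G w u v = setWeight w (twoForests G u v) / setWeight w (spanningTrees G) := by
  rw [effRes_eq hT (isPotential_setWeight_twoForestsWith G w u v), twoForestsWith_left,
    twoForestsWith_right, setWeight_empty, sub_zero]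

theorem effRes_comm (hT : setWeight w (spanningTrees G) ≠ 0) (u v : V) :
    effRes G w u v = effRes G w v u := by
  rw [effRes_eq_div hT, effRes_eq_div hT, twoForests_comm]

theorem effRes_add_effRes_sub_effRes (hT : setWeight w (spanningTrees G) ≠ 0) (s₁ s₂ q : V) :
    effRes G w s₂ q + effRes G w s₁ s₂ - effRes G w s₁ q =
      2 * setWeight w (twoForestsWith G s₁ q s₂) / setWeight w (spanningTrees G) := by
  rw [two_mul_setWeight_twoForestsWith, effRes_eq_div hT, effRes_eq_div hT, effRes_eq_div hT,
    sub_div, add_div]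

theorem effRes_le_effRes_add_effRes (hw : ∀ e ∈ G.edgeSet, 0 ≤ w e)
    (hT : setWeight w (spanningTrees G) ≠ 0) (s₁ s₂ q : V) :
    effRes G w s₁ q ≤ effRes G w s₁ s₂ + effRes G w s₂ q := by
  have hF : 0 ≤ setWeight w (twoForestsWith G s₁ q s₂) := setWeight_nonneg hw fun _ h => h.1.1
  have hT' : 0 ≤ setWeight w (spanningTrees G) := setWeight_nonneg hw fun _ h => h.1
  have hgap : 0 ≤ effRes G w s₂ q + effRes G w s₁ s₂ - effRes G w s₁ q := by
    rw [effRes_add_effRes_sub_effRes hT]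
    positivity
  linarith

theorem connProb_eq_div (G : SimpleGraph V) (w : Sym2 V → ℝ) (s₁ s₂ q : V) :
    connProb G w s₁ s₂ q =
      setWeight w (twoForestsWith G s₁ q s₂) / setWeight w (twoForests G s₁ s₂) := by
  simp only [connProb, gibbsProb, setWeight, Finset.sum_div]

theorem connProb_eq_effRes_div (hT : setWeight w (spanningTrees G) ≠ 0) (s₁ s₂ q : V) :
    connProb G w s₁ s₂ q =
      (effRes G w s₂ q + effRes G w s₁ s₂ - effRes G w s₁ q) / (2 * effRes G w s₁ s₂) := by
  rw [effRes_add_effRes_sub_effRes hT, effRes_eq_div hT, connProb_eq_div, ← mul_div_assoc,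
    div_div_div_cancel_right₀ hT, mul_div_mul_left _ _ two_ne_zero]

theorem connProb_le_connProb_iff (hT : setWeight w (spanningTrees G) ≠ 0) {s₁ s₂ : V}
    (hR : 0 < effRes G w s₁ s₂) (q : V) :
    connProb G w s₂ s₁ q ≤ connProb G w s₁ s₂ q ↔ effRes G w s₁ q ≤ effRes G w s₂ q := by
  rw [connProb_eq_effRes_div hT s₁ s₂, connProb_eq_effRes_div hT s₂ s₁, effRes_comm hT s₂ s₁,
    div_le_div_iff_of_pos_right (by positivity)]
  constructor <;> intro h <;> linarith

end Resistance

end ProbWatershed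

open ProbWatershed in
theorem mainTheorem4 {V : Type*} [Fintype V] (G : SimpleGraph V) (w : Sym2 V → ℝ)
    (hw : ∀ e ∈ G.edgeSet, 0 ≤ w e) (hconn : (positivePart G w).Connected) :
    -- the effective resistance is well defined
    (∀ u v : V, (∃ ν : V → ℝ, IsPotential G w 1 u v ν) ∧
      ∀ (I : ℝ) (ν : V → ℝ), I ≠ 0 → IsPotential G w I u v ν →
        effRes G w u v = (ν u - ν v) / I) ∧
    -- it is the ratio of the weights of the 2-forests and of the spanning trees
    0 < setWeight w (spanningTrees G) ∧
    (∀ u v : V,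
      effRes G w u v = setWeight w (twoForests G u v) / setWeight w (spanningTrees G)) ∧
    -- the probability is the normalized gap in the triangle inequality
    (∀ s₁ s₂ q : V, s₁ ≠ s₂ →
      0 < setWeight w (twoForests G s₁ s₂) ∧
      0 < effRes G w s₁ s₂ ∧
      effRes G w s₁ q ≤ effRes G w s₁ s₂ + effRes G w s₂ q ∧
      connProb G w s₁ s₂ q =
        (effRes G w s₂ q + effRes G w s₁ s₂ - effRes G w s₁ q) / (2 * effRes G w s₁ s₂) ∧
      (connProb G w s₁ s₂ q ≥ connProb G w s₂ s₁ q ↔ effRes G w s₁ q ≤ effRes G w s₂ q)) := by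
  have hT := setWeight_spanningTrees_pos hw hconn
  refine ⟨fun u v => ⟨exists_isPotential hT.ne' 1 u v, fun I ν => effRes_eq⟩, hT,
    effRes_eq_div hT.ne', fun s₁ s₂ q hs => ?_⟩
  have hF := setWeight_twoForests_pos hw hconn hs
  have hR : 0 < effRes G w s₁ s₂ := by
    rw [effRes_eq_div hT.ne']
    exact div_pos hF hT
  exact ⟨hF, hR, effRes_le_effRes_add_effRes hw hT.ne' s₁ s₂ q,
    connProb_eq_effRes_div hT.ne' s₁ s₂ q, connProb_le_connProb_iff hT.ne' hR q⟩
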